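/- Let $G$ be the incremental algorithm for Delaunay triangulations that inserts the points of a sequence one by one as follows. To insert $p$, it starts in a triangle of the current triangulation incident to the most recently inserted point and walks to the triangle containing $p$, each step (a navigation operation) crossing an edge of the current triangle that has $p$ on its outer side; it then joins $p$ to the three vertices of that triangle and flips edges that violate the circumcircle condition until there are none. (The outside of the convex hull is triangulated by joining the hull edges to a vertex at infinity; an unbounded triangle contains $p$ if $p$ lies strictly on the outer side of its hull edge, and its circumdisk is the open half-plane on that side. The walk starts in a bounded triangle; the first three points form the initial triangle and require no operations.) Remaining choices (starting triangle, edge to cross, order of flips) may be made by $G$ in any way, as a function of the current triangulation, the last inserted point and the new point. For an integer $k>0$, a sequence of distinct planar points is $k$-D-linear if $G$, run on it, performs at most $k$ navigation operations and at most $k$ flips for each point; a D-linear run of $S$ (with threshold $k$) is a $k$-D-linear subsequence formed by consecutive points of $S$. The greedy partitioning algorithm runs $G$ on $S$ until a point requires more than $k$ navigation operations or more than $k$ flips; it then closes the current run and restarts $G$ with a new run beginning at that point, until no points are left. An optimal partition of $S$ is a partition into the minimum number of (nonempty) D-linear runs. **Lemma.** For every integer $k>0$ there is an integer $N$ such that for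 every $n\ge N$ and every such algorithm $G$ there exists a sequence of $n$ distinct planar points in general position (no three collinear, no four cocircular) on which the greedy partitioning algorithm yields exactly three D-linear runs, whereas an optimal partition of the sequence has exactly two D-linear runs. -/

import Mathlib

namespace DLinear

/-! ## Points, orientation test and incircle test -/

/-- A point of the plane, by its Cartesian coordinates. -/
abbrev Point := ℝ × ℝ

/-- The orientation test: positive, negative or zero according to whether `c` lies to the left of,
to the right of, or on the line directed from `a` to `b`. -/
noncomputable def orient (a b c : Point) : ℝ :=
  (b.1 - a.1) * (c.2 - a.2) - (b.2 - a.2) * (c.1 - a.1)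

/-- The incircle test: for a counterclockwise triangle `a b c` it is positive, negative or zero
according to whether `d` lies inside, outside or on the circle through `a`, `b`, `c`. -/
noncomputable def inCircle (a b c d : Point) : ℝ :=
  Matrix.det
    !![a.1 - d.1, a.2 - d.2, (a.1 - d.1) ^ 2 + (a.2 - d.2) ^ 2;
       b.1 - d.1, b.2 - d.2, (b.1 - d.1) ^ 2 + (b.2 - d.2) ^ 2;
       c.1 - d.1, c.2 - d.2, (c.1 - d.1) ^ 2 + (c.2 - d.2) ^ 2]

/-- The points of the sequence are distinct, no three are collinear and no four are cocircular. -/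
def GeneralPosition (S : List Point) : Prop :=
  S.Nodup ∧
  (∀ a ∈ S, ∀ b ∈ S, ∀ c ∈ S, [a, b, c].Nodup → orient a b c ≠ 0) ∧
  (∀ a ∈ S, ∀ b ∈ S, ∀ c ∈ S, ∀ d ∈ S, [a, b, c, d].Nodup → inCircle a b c d ≠ 0)

/-! ## Triangulations

A triangulation is stored as its set of counterclockwise triangles. The region outside the convex
hull is triangulated too, by means of one additional vertex at infinity (`none`): the hull edge that
has the triangulated region on its right when directed from `a` to `b` is a side of the unbounded
triangle `a b ∞`. -/

/-- A point of the plane, or the vertex at infinity `none`. -/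
abbrev Vertex := Option Point

/-- A triangle, as a cyclically ordered list of vertices. -/
abbrev Face := Cycle Vertex

/-- The triangle with vertices `a`, `b`, `c` in this cyclic order. -/
def face (a b c : Vertex) : Face := (([a, b, c] : List Vertex) : Cycle Vertex)

/-- The triangulation of a counterclockwise triangle `a b c`, with its three unbounded triangles. -/
def triangle (a b c : Point) : Set Face :=
  {face a b c, face b a none, face c b none, face a c none}

open Classical in
/-- The triangulation of three noncollinear points. -/
noncomputable def initial (a b c : Point) : Set Face :=
  if 0 < orient a b c then triangle a b c else triangle b a c

/-! ## Locating a point -/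

/-- The triangle `t` contains `p`: a bounded triangle has `p` on the inner side of each of its
edges, an unbounded one has `p` on the outer side of its hull edge. -/
def Contains (t : Face) (p : Point) : Prop :=
  (∃ a b c : Point, t = face a b c ∧
    0 ≤ orient a b p ∧ 0 ≤ orient b c p ∧ 0 ≤ orient c a p) ∨
  (∃ a b : Point, t = face a b none ∧ 0 < orient a b p)

/-- One navigation operation: in the triangulation `T`, an edge `a b` of the bounded triangle `t`
has `p` on its outer side, and the walk crosses this edge into the adjacent triangle `t'`. -/
def Cross (T : Set Face) (p : Point) (t t' : Face) : Prop :=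
  ∃ (a b c : Point) (d : Vertex),
    t = face a b c ∧ t' = face b a d ∧ t ∈ T ∧ t' ∈ T ∧ orient a b p < 0

/-- `Walk T p t i t'`: from the triangle `t`, a walk in the direction of `p` reaches the triangle
`t'` that contains `p` after `i` navigation operations. -/
inductive Walk (T : Set Face) (p : Point) : Face → ℕ → Face → Prop
  | arrived {t : Face} : t ∈ T → Contains t p → Walk T p t 0 t
  | step {t t' t'' : Face} {i : ℕ} :
      Cross T p t t' → Walk T p t' i t'' → Walk T p t (i + 1) t''

/-! ## Updating the triangulation -/

/-- The point `p` violates the circumcircle condition of the triangle `a b c`. The circumdisk of an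
unbounded triangle is the open half-plane on the outer side of its hull edge. -/
def InDisk : Vertex → Vertex → Vertex → Point → Prop
  | some a, some b, some c, p => 0 < inCircle a b c p
  | some a, some b, none, p => 0 < orient a b p
  | none, some a, some b, p => 0 < orient a b p
  | some b, none, some a, p => 0 < orient a b p
  | _, _, _, _ => False

/-- Replace the triangle `a b c` by the three triangles that join `p` to its edges. -/
def split (T : Set Face) (a b c : Vertex) (p : Point) : Set Face :=
  (T \ {face a b c}) ∪ {face a b p, face b c p, face c a p}

/-- `T'` results from `T` by one flip: an edge `a b`, shared by the triangles `a b c` and `b a d`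
and invalid because `d` violates the circumcircle condition of `a b c`, is replaced by `c d`. -/
def Flip (T T' : Set Face) : Prop :=
  ∃ (a b c : Vertex) (d : Point),
    face a b c ∈ T ∧ face b a d ∈ T ∧ InDisk a b c d ∧
    T' = (T \ {face a b c, face b a d}) ∪ {face a d c, face d b c}

/-- `Flips T j T'`: a sequence of `j` flips transforms `T` into `T'`. -/
inductive Flips : Set Face → ℕ → Set Face → Prop
  | refl (T : Set Face) : Flips T 0 T
  | step {T T' T'' : Set Face} {j : ℕ} : Flip T T' → Flips T' j T'' → Flips T (j + 1) T''

/-! ## The incremental algorithm -/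

/-- What an insertion returns: the number of navigation operations, the number of flips, and the
new triangulation. -/
structure Outcome where
  nav : ℕ
  flips : ℕ
  next : Set Face

/-- `o` is the outcome of a correct insertion of `p` into the triangulation `T` whose most recently
inserted point is `q`: a walk that starts at some bounded triangle incident to `q` finds the
triangle containing `p`, this triangle is split, and then invalid edges are flipped until none is
left. -/
def Insertion (T : Set Face) (q p : Point) (o : Outcome) : Prop :=
  ∃ t ∈ T, (none : Vertex) ∉ t ∧ (some q : Vertex) ∈ t ∧
    ∃ a b c : Vertex, Walk T p t o.nav (face a b c) ∧
      Flips (split T a b c p) o.flips o.next ∧ ¬ ∃ T', Flip o.next T'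

/-- An incremental algorithm: it resolves in any way whatsoever the choices that an insertion
leaves open (the starting triangle, the edge to cross next, the edge to flip next). -/
structure IncrementalAlgorithm where
  insert : Set Face → Point → Point → Outcome
  correct : ∀ T q p, (∃ o, Insertion T q p o) → Insertion T q p (insert T q p)

instance : Nonempty IncrementalAlgorithm := by
  classical
  refine ⟨⟨fun T q p => if h : ∃ o, Insertion T q p o then h.choose else ⟨0, 0, ∅⟩, ?_⟩⟩
  intro T q p h
  simp only [dif_pos h]
  exact h.choose_spec

/-! ## Runs and partitions into runs -/

/-- Continuing with the points of the list from the triangulation `T`, whose most recently inserted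
point is `q`, the algorithm performs for each point at most `k` navigation operations and at most
`k` flips. -/
def LinearFrom (G : IncrementalAlgorithm) (k : ℕ) : Set Face → Point → List Point → Prop
  | _, _, [] => True
  | T, q, p :: S =>
      Insertion T q p (G.insert T q p) ∧
      (G.insert T q p).nav ≤ k ∧ (G.insert T q p).flips ≤ k ∧
      LinearFrom G k (G.insert T q p).next p S

/-- `k`-D-linear sequences (in general position). The first three points need neither navigation
nor flips. -/
def KDLinear (G : IncrementalAlgorithm) (k : ℕ) : List Point → Prop
  | a :: b :: c :: S => LinearFrom G k (initial a b c) c S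
  | _ => True

open Classical in
/-- The greedy partitioning algorithm with current run `cur` and remaining points `S`: the next
point joins the current run if the number of operations permits, and starts a new run otherwise. -/
noncomputable def greedyFrom (G : IncrementalAlgorithm) (k : ℕ) (cur : List Point) :
    List Point → List (List Point)
  | [] => [cur]
  | p :: S =>
      if KDLinear G k (cur ++ [p]) then greedyFrom G k (cur ++ [p]) S
      else cur :: greedyFrom G k [p] S

/-- The list of runs that the greedy partitioning algorithm yields. -/
noncomputable def greedyPartition (G : IncrementalAlgorithm) (k : ℕ) :
    List Point → List (List Point)
  | [] => []
  | p :: S => greedyFrom G k [p] S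

/-- `R` is a partition of the sequence `S` into nonempty `k`-D-linear runs of consecutive points. -/
def IsRunPartition (G : IncrementalAlgorithm) (k : ℕ) (S : List Point) (R : List (List Point)) :
    Prop :=
  R.flatten = S ∧ ∀ r ∈ R, r ≠ [] ∧ KDLinear G k r

end DLinear

namespace DLinear

/-! ## Faces -/

/-! All points lie on the parabola `y = x ^ 2` at positive abscissas. There the orientation and
incircle signs depend only on the order of the abscissas (`orient_P`, `inCircle_P`), and the
Delaunay triangulation is the fan centred at the leftmost point. Three insertions into a fan matter,
and the operations counted in each are not affected by the choices of `G`: a new second smallest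
point, after the previous one, costs one crossing and no flip (`insertion_fan_iff`); a new smallest
point flips every spoke to the old centre except the last one, so a decreasing sequence becomes too
expensive (`not_kdLinear_decreasing`); a new largest point, after the second smallest, forces a walk
across the whole fan (`not_kdLinear_fan_largest`).

The sequence is `1, a 0, …, a (L + 1), c 0, …, c (M + 1)` with `a` and `c` decreasing and `1 < a i <
c j`. The greedy run from `1` takes in all of `a` and breaks at `c 0` because of the walk. The run
from `c 0` is decreasing, and `M` is chosen so that it breaks exactly at the last point. Cutting one
point earlier, before `a (L + 1)`, makes that point the centre of a fan that absorbs all of `c`, so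
two runs suffice. -/

theorem face_eq_iff {a b c a' b' c' : Vertex} :
    face a b c = face a' b' c' ↔
      (a = a' ∧ b = b' ∧ c = c') ∨ (a = b' ∧ b = c' ∧ c = a') ∨ (a = c' ∧ b = a' ∧ c = b') := by
  constructor
  · intro h
    have h' : ([a, b, c] : List Vertex) ~r [a', b', c'] := Quotient.exact h
    obtain ⟨n, hn, hr⟩ := List.isRotated_iff_mod.1 h'
    simp only [List.length_cons, List.length_nil] at hn
    interval_cases n <;> simp [List.rotate] at hr <;> tauto
  · rintro (⟨rfl, rfl, rfl⟩ | ⟨rfl, rfl, rfl⟩ | ⟨rfl, rfl, rfl⟩)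
    · rfl
    · exact Quotient.sound ⟨2, rfl⟩
    · exact Quotient.sound ⟨1, rfl⟩

theorem face_rotate (a b c : Vertex) : face a b c = face b c a :=
  face_eq_iff.2 (by simp)

theorem inCircle_rotate (a b c d : Point) : inCircle a b c d = inCircle b c a d := by
  simp only [inCircle, Matrix.det_fin_three, Matrix.of_apply, Matrix.cons_val]
  ring

theorem InDisk.rotate {a b c : Vertex} {p : Point} (h : InDisk a b c p) : InDisk b c a p := by
  rcases a with _ | a <;> rcases b with _ | b <;> rcases c with _ | c <;>
    simp only [InDisk] at h ⊢ <;> try assumption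
  rwa [← inCircle_rotate]

theorem InDisk.of_face_eq {a b c a' b' c' : Vertex} {p : Point} (h : InDisk a b c p)
    (e : face a b c = face a' b' c') : InDisk a' b' c' p := by
  rcases face_eq_iff.1 e with ⟨rfl, rfl, rfl⟩ | ⟨rfl, rfl, rfl⟩ | ⟨rfl, rfl, rfl⟩
  exacts [h, h.rotate.rotate, h.rotate]

/-- An insertion names the located triangle by some rotation of its vertices; this makes the choice
of rotation harmless. -/
theorem split_of_face_eq {a b c a' b' c' : Vertex} (T : Set Face) (p : Point)
    (e : face a b c = face a' b' c') : split T a b c p = split T a' b' c' p := by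
  unfold split
  rw [e]
  congr 1
  rcases face_eq_iff.1 e with ⟨rfl, rfl, rfl⟩ | ⟨rfl, rfl, rfl⟩ | ⟨rfl, rfl, rfl⟩ <;>
    ext f <;> simp only [Set.mem_insert_iff, Set.mem_singleton_iff] <;> tauto

theorem contains_bounded {a b c p : Point} (h : Contains (face a b c) p) :
    0 ≤ orient a b p ∧ 0 ≤ orient b c p ∧ 0 ≤ orient c a p := by
  rcases h with ⟨a', b', c', e, h⟩ | ⟨a', b', e, h⟩
  · rcases face_eq_iff.1 e with e | e | e <;> simp only [Option.some.injEq] at e <;>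
      obtain ⟨rfl, rfl, rfl⟩ := e <;> tauto
  · simp [face_eq_iff] at e

theorem not_cross_unbounded {T : Set Face} {a b : Vertex} {p : Point} {t : Face} :
    ¬ Cross T p (face a b none) t := by
  rintro ⟨a', b', c', d, e, -⟩
  simp [face_eq_iff] at e

/-! ## Points of the parabola -/

/-- The point of the parabola `y = x ^ 2` with abscissa `x`. -/
def P (x : ℝ) : Point := (x, x ^ 2)

@[simp] theorem P_inj {x y : ℝ} : P x = P y ↔ x = y := by
  simp only [P, Prod.mk.injEq, and_iff_left_iff_imp]
  rintro rfl
  rfl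

theorem orient_P (a b c : ℝ) : orient (P a) (P b) (P c) = (b - a) * (c - a) * (c - b) := by
  simp only [orient, P]
  ring

/-- A Vandermonde product times the sum of the abscissas. For positive abscissas the last factor is
positive, so the sign depends on the order alone. -/
theorem inCircle_P (a b c d : ℝ) : inCircle (P a) (P b) (P c) (P d) =
    -((b - a) * (c - a) * (c - b)) * ((d - a) * (d - b) * (d - c)) * (a + b + c + d) := by
  simp only [inCircle, P, Matrix.det_fin_three, Matrix.of_apply, Matrix.cons_val]
  ring

theorem generalPosition_map_P {l : List ℝ} (hl : l.Nodup) (hpos : ∀ x ∈ l, 0 < x) :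
    GeneralPosition (l.map P) := by
  refine ⟨hl.map fun x y h => P_inj.1 h, ?_, ?_⟩
  · simp only [List.forall_mem_map]
    intro a _ b _ c _ h
    simp only [List.nodup_cons, List.mem_cons, P_inj, List.not_mem_nil, or_false, not_or] at h
    obtain ⟨⟨h1, h2⟩, h3, -⟩ := h
    rw [orient_P]
    simp [sub_eq_zero, Ne.symm h1, Ne.symm h2, Ne.symm h3]
  · simp only [List.forall_mem_map]
    intro a ha b hb c hc d hd h
    simp only [List.nodup_cons, List.mem_cons, P_inj, List.not_mem_nil, or_false, not_or] at h
    obtain ⟨⟨h1, h2, h3⟩, ⟨h4, h5⟩, h6, -⟩ := h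
    have := hpos a ha
    have := hpos b hb
    have := hpos c hc
    have := hpos d hd
    have hs : a + b + c + d ≠ 0 := by positivity
    rw [inCircle_P]
    simp [sub_eq_zero, Ne.symm h1, Ne.symm h2, Ne.symm h3, Ne.symm h4, Ne.symm h5, Ne.symm h6, hs]

/-! ## Fans -/

/-- The fan triangulation with centre `P z` of the points `P z` and `P (c i)`, `i < m`, where
`c` is decreasing and `z` is smaller than its values. -/
inductive Fan (z : ℝ) (c : ℕ → ℝ) (m : ℕ) : Set Face
  | bounded (i : ℕ) : i + 1 < m →
      Fan z c m (face (some (P z)) (some (P (c (i + 1)))) (some (P (c i))))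
  | hull (i : ℕ) : i + 1 < m → Fan z c m (face (some (P (c i))) (some (P (c (i + 1)))) none)
  | first : Fan z c m (face (some (P z)) (some (P (c 0))) none)
  | last : Fan z c m (face (some (P (c (m - 1)))) (some (P z)) none)

theorem mem_fan {z : ℝ} {c : ℕ → ℝ} {m : ℕ} {f : Face} : f ∈ Fan z c m ↔
    (∃ i, i + 1 < m ∧ f = face (some (P z)) (some (P (c (i + 1)))) (some (P (c i)))) ∨
    (∃ i, i + 1 < m ∧ f = face (some (P (c i))) (some (P (c (i + 1)))) none) ∨
    f = face (some (P z)) (some (P (c 0))) none ∨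
    f = face (some (P (c (m - 1)))) (some (P z)) none := by
  constructor
  · rintro (⟨i, hi⟩ | ⟨i, hi⟩ | _ | _)
    exacts [.inl ⟨i, hi, rfl⟩, .inr (.inl ⟨i, hi, rfl⟩), .inr (.inr (.inl rfl)),
      .inr (.inr (.inr rfl))]
  · rintro (⟨i, hi, rfl⟩ | ⟨i, hi, rfl⟩ | rfl | rfl)
    exacts [.bounded i hi, .hull i hi, .first, .last]

theorem vertex_mem_of_mem_fan {z : ℝ} {c : ℕ → ℝ} {m : ℕ} (hm : 0 < m) {a b : Vertex} {d : Point}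
    (h : face a b (some d) ∈ Fan z c m) : d = P z ∨ ∃ i < m, d = P (c i) := by
  rcases mem_fan.1 h with ⟨i, hi, e⟩ | ⟨i, hi, e⟩ | e | e <;>
    rcases face_eq_iff.1 e with ⟨h1, h2, h3⟩ | ⟨h1, h2, h3⟩ | ⟨h1, h2, h3⟩ <;>
    simp only [Option.some.injEq, reduceCtorEq] at h3 <;> subst h3
  · exact .inr ⟨i, by omega, rfl⟩
  · exact .inl rfl
  · exact .inr ⟨i + 1, by omega, rfl⟩
  · exact .inr ⟨i, by omega, rfl⟩
  · exact .inr ⟨i + 1, by omega, rfl⟩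
  · exact .inl rfl
  · exact .inr ⟨0, by omega, rfl⟩
  · exact .inr ⟨m - 1, by omega, rfl⟩
  · exact .inl rfl

/-! ### Fans are Delaunay -/

/-- No term lies strictly between two consecutive ones. This is the form in which emptiness of
circumdisks and of outer half-planes is checked. -/
theorem sub_mul_sub_nonneg_of_strictAnti {c : ℕ → ℝ} (hc : StrictAnti c) (i l : ℕ) :
    0 ≤ (c l - c (i + 1)) * (c l - c i) := by
  rcases le_or_gt l i with h | h
  · have h1 := hc.antitone h
    have h2 := hc.antitone (Nat.le_succ i)
    simp only [Nat.succ_eq_add_one] at h2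
    exact mul_nonneg (by linarith) (by linarith)
  · have h1 := hc.antitone (Nat.succ_le_of_lt h)
    have h2 := hc.antitone (Nat.le_succ i)
    simp only [Nat.succ_eq_add_one] at h1 h2
    exact mul_nonneg_of_nonpos_of_nonpos (by linarith) (by linarith)

/-- Ears `z c_{i+1} c_i` have no point of the sequence in their circumdisk. -/
theorem not_inDisk_bounded {z y a b : ℝ} (hz : 0 < z) (hb : z < b) (hab : b < a)
    (hy : z ≤ y) (h : 0 ≤ (y - b) * (y - a)) :
    ¬ InDisk (some (P z)) (some (P b)) (some (P a)) (P y) := by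
  simp only [InDisk, inCircle_P, not_lt]
  have h1 : 0 ≤ (b - z) * (a - z) * (a - b) := by
    have := sub_pos.2 hb
    have := sub_pos.2 hab
    have := sub_pos.2 (hb.trans hab)
    positivity
  have h2 : 0 ≤ (y - z) * ((y - b) * (y - a)) := mul_nonneg (sub_nonneg.2 hy) h
  have h3 : 0 ≤ z + b + a + y := by linarith
  have := mul_nonneg (mul_nonneg h1 h2) h3
  linarith [this]

theorem not_inDisk_hull {y a b : ℝ} (hab : b < a) (h : 0 ≤ (y - b) * (y - a)) :
    ¬ InDisk (some (P a)) (some (P b)) none (P y) := by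
  simp only [InDisk, orient_P, not_lt]
  nlinarith [mul_nonneg (sub_nonneg.2 hab.le) h]

theorem not_inDisk_first {y a z : ℝ} (hz : z ≤ a) (h1 : z ≤ y) (h2 : y ≤ a) :
    ¬ InDisk (some (P z)) (some (P a)) none (P y) := by
  simp only [InDisk, orient_P, not_lt]
  exact mul_nonpos_of_nonneg_of_nonpos
    (mul_nonneg (sub_nonneg.2 hz) (sub_nonneg.2 h1)) (sub_nonpos.2 h2)

/-- A flip needs a vertex of the triangulation inside the circumdisk of a face; in a fan no vertex
lies in the circumdisk of any face, adjacent or not. -/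
theorem not_flip_fan {z : ℝ} {c : ℕ → ℝ} {m : ℕ} (hm : 0 < m) (hc : StrictAnti c) (hz0 : 0 < z)
    (hz : ∀ i < m, z < c i) (T' : Set Face) : ¬ Flip (Fan z c m) T' := by
  rintro ⟨a, b, x, d, h1, h2, h3, -⟩
  obtain ⟨y, rfl, hy⟩ : ∃ y, d = P y ∧ (y = z ∨ ∃ i < m, y = c i) := by
    rcases vertex_mem_of_mem_fan hm h2 with rfl | ⟨i, hi, rfl⟩
    exacts [⟨z, rfl, .inl rfl⟩, ⟨c i, rfl, .inr ⟨i, hi, rfl⟩⟩]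
  have hzy : z ≤ y := by
    rcases hy with rfl | ⟨i, hi, rfl⟩
    exacts [le_rfl, (hz i hi).le]
  have hyc : y ≤ c 0 := by
    rcases hy with rfl | ⟨i, hi, rfl⟩
    exacts [(hz 0 hm).le, hc.antitone i.zero_le]
  have hgap : ∀ i, i + 1 < m → 0 ≤ (y - c (i + 1)) * (y - c i) := by
    intro i hi
    rcases hy with rfl | ⟨l, hl, rfl⟩
    · exact mul_nonneg_of_nonpos_of_nonpos (sub_nonpos.2 (hz _ hi).le)
        (sub_nonpos.2 (hz _ (by omega)).le)
    · exact sub_mul_sub_nonneg_of_strictAnti hc i l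
  rcases mem_fan.1 h1 with ⟨i, hi, e⟩ | ⟨i, hi, e⟩ | e | e
  · exact not_inDisk_bounded hz0 (hz _ hi) (hc (Nat.lt_succ_self i)) hzy (hgap i hi)
      (h3.of_face_eq e)
  · exact not_inDisk_hull (hc (Nat.lt_succ_self i)) (hgap i hi) (h3.of_face_eq e)
  · exact not_inDisk_first (hz 0 hm).le hzy hyc (h3.of_face_eq e)
  · refine not_inDisk_hull (hz _ (by omega)) ?_ (h3.of_face_eq e)
    rcases hy with rfl | ⟨l, hl, rfl⟩
    · simp
    · exact mul_nonneg (sub_nonneg.2 hzy) (sub_nonneg.2 (hc.antitone (by omega)))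

/-! ### Walks in a fan -/

/-- The neighbour across a spoke is unique, so a walk that crosses spokes has no freedom. -/
theorem eq_of_face_mem_fan {z : ℝ} {c : ℕ → ℝ} {m i : ℕ} (hc : StrictAnti c)
    (hz : ∀ i < m, z < c i) (hi : i < m) {d : Vertex}
    (h : face (some (P z)) (some (P (c i))) d ∈ Fan z c m) :
    (i = 0 ∧ d = none) ∨ ∃ j, i = j + 1 ∧ d = some (P (c j)) := by
  have hci : ∀ i j, c i = c j ↔ i = j := fun _ _ => hc.injective.eq_iff
  have hne : ∀ i < m, z ≠ c i := fun i hi => (hz i hi).ne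
  rcases mem_fan.1 h with ⟨l, hl, e⟩ | ⟨l, hl, e⟩ | e | e <;>
    rcases face_eq_iff.1 e with ⟨h1, h2, h3⟩ | ⟨h1, h2, h3⟩ | ⟨h1, h2, h3⟩ <;>
    simp only [Option.some.injEq, P_inj, reduceCtorEq, hci] at h1 h2 <;>
    first
    | exact .inr ⟨l, h2, h3⟩
    | exact .inl ⟨h2, h3⟩
    | exact absurd h1 (hne _ (by omega))

theorem eq_of_face_mem_fan_last {z : ℝ} {c : ℕ → ℝ} {m : ℕ} (hc : StrictAnti c)
    (hz : ∀ i < m, z < c i) (hm : 0 < m) {d : Vertex}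
    (h : face (some (P (c (m - 1)))) (some (P z)) d ∈ Fan z c m) : d = none := by
  have hci : ∀ i j, c i = c j ↔ i = j := fun _ _ => hc.injective.eq_iff
  have hne : ∀ i < m, z ≠ c i := fun i hi => (hz i hi).ne
  rcases mem_fan.1 h with ⟨l, hl, e⟩ | ⟨l, hl, e⟩ | e | e <;>
    rcases face_eq_iff.1 e with ⟨h1, h2, h3⟩ | ⟨h1, h2, h3⟩ | ⟨h1, h2, h3⟩ <;>
    simp only [Option.some.injEq, P_inj, reduceCtorEq, hci] at h1 h2 <;>
    first
    | exact h3
    | exact absurd h2 (hne _ (by omega))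
    | omega

/-- With two edges ruled out as exits, the crossing has to use the third edge `w u`; this removes
the choice of edge from `G`. -/
theorem exists_of_cross_third {T : Set Face} {u v w p : Point} {t : Face}
    (h : Cross T p (face u v w) t) (h1 : 0 ≤ orient u v p) (h2 : 0 ≤ orient v w p) :
    ∃ d : Vertex, t = face u w d ∧ face u w d ∈ T := by
  obtain ⟨a, b, c, d, e, rfl, -, ht, ho⟩ := h
  rcases face_eq_iff.1 e with e | e | e <;> simp only [Option.some.injEq] at e <;>
    obtain ⟨rfl, rfl, rfl⟩ := e
  · exact absurd h1 (not_le.2 ho)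
  · exact ⟨d, rfl, ht⟩
  · exact absurd h2 (not_le.2 ho)

theorem Walk.arrived_or_step {T : Set Face} {p : Point} {t t'' : Face} {n : ℕ}
    (h : Walk T p t n t'') : (n = 0 ∧ t'' = t ∧ Contains t p) ∨
      ∃ i t', n = i + 1 ∧ Cross T p t t' ∧ Walk T p t' i t'' := by
  cases h with
  | arrived h1 h2 => exact .inl ⟨rfl, rfl, h2⟩
  | step hx hw => exact .inr ⟨_, _, rfl, hx, hw⟩

/-- A walk in a fan towards a point outside the edge `P z`, `P (c 0)`. -/
theorem walk_fan_outside {z y : ℝ} {c : ℕ → ℝ} {m : ℕ} (hc : StrictAnti c)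
    (hz : ∀ i < m, z < c i) (hy : y < z ∨ c 0 < y) {i n : ℕ} (hi : i + 1 < m) {t : Face}
    (h : Walk (Fan z c m) (P y) (face (some (P z)) (some (P (c (i + 1)))) (some (P (c i)))) n t) :
    i + 1 ≤ n ∧ t = face (some (P z)) (some (P (c 0))) none := by
  -- Every spoke separates `P y` from the triangle on its far side, and `key2` rules out the exit
  -- through the hull edge: the walk must cross the spokes to `c i, …, c 0` in turn.
  have key : ∀ i < m, orient (P (c i)) (P z) (P y) < 0 ∧ 0 < orient (P z) (P (c i)) (P y) := by
    intro i hi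
    have h1 := hz i hi
    have h2 := hc.antitone i.zero_le
    have h3 : 0 < (y - z) * (y - c i) := by
      rcases hy with h | h
      · exact mul_pos_of_neg_of_neg (by linarith) (by linarith)
      · exact mul_pos (by linarith) (by linarith)
    rw [orient_P, orient_P]
    constructor <;> nlinarith
  have key2 : ∀ i, i + 1 < m → 0 < orient (P (c (i + 1))) (P (c i)) (P y) := by
    intro i hi
    have h1 := hz _ hi
    have h2 := hc (Nat.lt_succ_self i)
    have h4 := hc.antitone i.zero_le
    have h3 : 0 < (y - c (i + 1)) * (y - c i) := by
      simp only [Nat.succ_eq_add_one] at h2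
      rcases hy with h | h
      · exact mul_pos_of_neg_of_neg (by linarith) (by linarith)
      · exact mul_pos (by linarith) (by linarith)
    rw [orient_P, mul_assoc]
    exact mul_pos (sub_pos.2 h2) h3
  induction i using Nat.strong_induction_on generalizing n with
  | _ i ih =>
    rcases h.arrived_or_step with ⟨-, -, h2⟩ | ⟨l, t', rfl, hx, hw⟩
    · exact absurd (contains_bounded h2).2.2 (not_le.2 (key i (by omega)).1)
    obtain ⟨d, rfl, hd⟩ := exists_of_cross_third hx (key _ hi).2.le (key2 i hi).le
    rcases eq_of_face_mem_fan hc hz (by omega) hd with ⟨rfl, rfl⟩ | ⟨j, rfl, rfl⟩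
    · rcases hw.arrived_or_step with ⟨-, h, -⟩ | ⟨_, _, -, hx, -⟩
      · exact ⟨by omega, h⟩
      · exact absurd hx not_cross_unbounded
    · obtain ⟨h1, h2⟩ := ih j (by omega) (by omega) hw
      exact ⟨by omega, h2⟩

theorem mem_face {u a b c : Vertex} : u ∈ face a b c ↔ u = a ∨ u = b ∨ u = c := by
  simp [face]

theorem bounded_of_mem_fan {z : ℝ} {c : ℕ → ℝ} {m : ℕ} {t : Face} (h : t ∈ Fan z c m)
    (hn : (none : Vertex) ∉ t) :
    ∃ i, i + 1 < m ∧ t = face (some (P z)) (some (P (c (i + 1)))) (some (P (c i))) := by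
  rcases mem_fan.1 h with h | ⟨i, hi, rfl⟩ | rfl | rfl
  · exact h
  all_goals exact absurd (by simp [mem_face]) hn

/-! ### Inserting a new second smallest point into a fan -/

theorem fan_succ (z : ℝ) {c : ℕ → ℝ} (hc : StrictAnti c) {m : ℕ} (hz : ∀ i < m + 2, z < c i) :
    split (Fan z c (m + 1)) (some (P (c m))) (some (P z)) none (P (c (m + 1))) =
      Fan z c (m + 2) := by
  have hci : ∀ i j, c i = c j ↔ i = j := fun _ _ => hc.injective.eq_iff
  have hne : ∀ i < m + 2, c i ≠ z := fun i hi => (hz i hi).ne'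
  have hne' : ∀ i < m + 2, z ≠ c i := fun i hi => (hz i hi).ne
  ext f
  simp only [split, Set.mem_union, Set.mem_sdiff, Set.mem_singleton_iff, Set.mem_insert_iff]
  constructor
  · rintro (⟨h, hf⟩ | rfl | rfl | rfl)
    · rcases mem_fan.1 h with ⟨i, hi, rfl⟩ | ⟨i, hi, rfl⟩ | rfl | rfl
      · exact .bounded i (by omega)
      · exact .hull i (by omega)
      · exact .first
      · exact absurd rfl hf
    · rw [face_rotate]; exact .bounded m (by omega)
    · rw [face_rotate, face_rotate]; exact .last
    · rw [face_rotate]; exact .hull m (by omega)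
  · intro h
    rcases mem_fan.1 h with ⟨i, hi, rfl⟩ | ⟨i, hi, rfl⟩ | rfl | rfl
    · rcases (by omega : i < m ∨ i = m) with hi | rfl
      · exact .inl ⟨.bounded i (by omega), by simp [face_eq_iff]⟩
      · exact .inr (.inl (by simp [face_eq_iff]))
    · rcases (by omega : i < m ∨ i = m) with hi | rfl
      · exact .inl ⟨.hull i (by omega), by simp [face_eq_iff, hne (i + 1) (by omega)]⟩
      · exact .inr (.inr (.inr (by simp [face_eq_iff])))
    · exact .inl ⟨.first, by simp [face_eq_iff, hne' m (by omega)]⟩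
    · exact .inr (.inr (.inl (by simp [face_eq_iff])))

theorem flips_of_not_flip {T T' : Set Face} {j : ℕ} (hT : ∀ T', ¬ Flip T T') (h : Flips T j T') :
    j = 0 ∧ T' = T := by
  cases h with
  | refl => exact ⟨rfl, rfl⟩
  | step h _ => exact absurd h (hT _)

/-- Inserting the new second smallest point after the old one takes one navigation operation and
no flips. -/
theorem insertion_fan_iff {z : ℝ} {c : ℕ → ℝ} (hc : StrictAnti c) (hz0 : 0 < z)
    (hz : ∀ i, z < c i) (m : ℕ) (o : Outcome) :
    Insertion (Fan z c (m + 2)) (P (c (m + 1))) (P (c (m + 2))) o ↔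
      o.nav = 1 ∧ o.flips = 0 ∧ o.next = Fan z c (m + 3) := by
  have hci : ∀ i j, c i = c j ↔ i = j := fun _ _ => hc.injective.eq_iff
  have hflip : ∀ T', ¬ Flip (Fan z c (m + 3)) T' :=
    not_flip_fan (by omega) hc hz0 fun i _ => hz i
  have hout : orient (P z) (P (c (m + 1))) (P (c (m + 2))) < 0 := by
    rw [orient_P]
    exact mul_neg_of_pos_of_neg (mul_pos (sub_pos.2 (hz _)) (sub_pos.2 (hz _)))
      (sub_neg.2 (hc (Nat.lt_succ_self _)))
  have hin : 0 < orient (P (c (m + 1))) (P z) (P (c (m + 2))) := by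
    rw [orient_P]
    exact mul_pos (mul_pos_of_neg_of_neg (sub_neg.2 (hz _))
      (sub_neg.2 (hc (Nat.lt_succ_self _)))) (sub_pos.2 (hz _))
  constructor
  · rintro ⟨t, ht, hn, hq, u, v, w, hw, hfl, -⟩
    obtain ⟨i, hi, rfl⟩ := bounded_of_mem_fan ht hn
    -- The last inserted point is an end of the fan and lies on a single bounded triangle, so the
    -- start of the walk is forced.
    have him : i = m := by
      simp only [mem_face, Option.some.injEq, P_inj, hci, (hz _).ne', false_or] at hq
      omega
    subst him
    have hin2 : 0 ≤ orient (P (c (i + 1))) (P (c i)) (P (c (i + 2))) := by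
      rw [orient_P]
      exact (mul_pos_of_neg_of_neg (mul_neg_of_pos_of_neg (sub_pos.2 (hc (Nat.lt_succ_self _)))
        (sub_neg.2 (hc (Nat.lt_succ_self _)))) (sub_neg.2 (hc (by omega)))).le
    have hin3 : 0 ≤ orient (P (c i)) (P z) (P (c (i + 2))) := by
      rw [orient_P]
      exact (mul_pos (mul_pos_of_neg_of_neg (sub_neg.2 (hz _))
        (sub_neg.2 (hc (by omega)))) (sub_pos.2 (hz _))).le
    rcases hw.arrived_or_step with ⟨-, -, h2⟩ | ⟨l, t', hl, hx, hw⟩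
    · exact absurd (contains_bounded h2).1 (not_le.2 hout)
    rw [face_rotate] at hx
    obtain ⟨d, rfl, hd⟩ := exists_of_cross_third hx hin2 hin3
    obtain rfl := eq_of_face_mem_fan_last (m := i + 2) hc (fun i _ => hz i) (by omega) hd
    rcases hw.arrived_or_step with ⟨rfl, hface, -⟩ | ⟨_, _, -, hx, -⟩
    · rw [split_of_face_eq _ _ hface, fan_succ z hc fun i _ => hz i] at hfl
      obtain ⟨h3, h4⟩ := flips_of_not_flip hflip hfl
      exact ⟨hl, h3, h4⟩
    · exact absurd hx not_cross_unbounded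
  -- This direction supplies the existence of an insertion, without which `G.correct` promises
  -- nothing.
  · obtain ⟨n, j, T⟩ := o
    rintro ⟨rfl, rfl, rfl⟩
    refine ⟨_, .bounded m (by omega), by simp [mem_face], by simp [mem_face],
      _, _, _, .step (t' := face (some (P (c (m + 1)))) (some (P z)) none)
        ⟨P z, P (c (m + 1)), P (c m), none, rfl, rfl, .bounded m (by omega), .last, hout⟩
        (.arrived .last (.inr ⟨_, _, rfl, hin⟩)), ?_, fun ⟨T', h⟩ => hflip T' h⟩
    rw [fan_succ z hc fun i _ => hz i]
    exact .refl _

/-! ## Inserting a new smallest point into a fan -/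

/-- The triangulation reached from the fan with centre `P z` of `P (c i)`, `i ≤ m`, after inserting
a point `P p` with `p < z` and flipping the edges from `P z` to `P (c i)`, `i < j`. -/
inductive Turn (p z : ℝ) (c : ℕ → ℝ) (m j : ℕ) : Set Face
  | center : Turn p z c m j (face (some (P p)) (some (P z)) (some (P (c j))))
  | flipped (i : ℕ) : i < j →
      Turn p z c m j (face (some (P p)) (some (P (c (i + 1)))) (some (P (c i))))
  | old (i : ℕ) : j ≤ i → i < m →
      Turn p z c m j (face (some (P z)) (some (P (c (i + 1)))) (some (P (c i))))
  | hull (i : ℕ) : i < m → Turn p z c m j (face (some (P (c i))) (some (P (c (i + 1)))) none)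
  | last : Turn p z c m j (face (some (P (c m))) (some (P z)) none)
  | left : Turn p z c m j (face (some (P z)) (some (P p)) none)
  | first : Turn p z c m j (face (some (P p)) (some (P (c 0))) none)

theorem mem_turn {p z : ℝ} {c : ℕ → ℝ} {m j : ℕ} {f : Face} : f ∈ Turn p z c m j ↔
    f = face (some (P p)) (some (P z)) (some (P (c j))) ∨
    (∃ i, i < j ∧ f = face (some (P p)) (some (P (c (i + 1)))) (some (P (c i)))) ∨
    (∃ i, j ≤ i ∧ i < m ∧ f = face (some (P z)) (some (P (c (i + 1)))) (some (P (c i)))) ∨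
    (∃ i, i < m ∧ f = face (some (P (c i))) (some (P (c (i + 1)))) none) ∨
    f = face (some (P (c m))) (some (P z)) none ∨
    f = face (some (P z)) (some (P p)) none ∨
    f = face (some (P p)) (some (P (c 0))) none := by
  constructor
  · rintro (_ | ⟨i, hi⟩ | ⟨i, hj, hi⟩ | ⟨i, hi⟩ | _ | _ | _)
    exacts [.inl rfl, .inr (.inl ⟨i, hi, rfl⟩), .inr (.inr (.inl ⟨i, hj, hi, rfl⟩)),
      .inr (.inr (.inr (.inl ⟨i, hi, rfl⟩))), .inr (.inr (.inr (.inr (.inl rfl)))),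
      .inr (.inr (.inr (.inr (.inr (.inl rfl))))), .inr (.inr (.inr (.inr (.inr (.inr rfl)))))]
  · rintro (rfl | ⟨i, hi, rfl⟩ | ⟨i, hj, hi, rfl⟩ | ⟨i, hi, rfl⟩ | rfl | rfl | rfl)
    exacts [.center, .flipped i hi, .old i hj hi, .hull i hi, .last, .left, .first]

theorem vertex_mem_of_mem_turn {p z : ℝ} {c : ℕ → ℝ} {m j : ℕ} (hj : j ≤ m) {a b : Vertex}
    {d : Point} (h : face a b (some d) ∈ Turn p z c m j) :
    d = P p ∨ d = P z ∨ ∃ i ≤ m, d = P (c i) := by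
  rcases mem_turn.1 h with e | ⟨i, hi, e⟩ | ⟨i, hj, hi, e⟩ | ⟨i, hi, e⟩ | e | e | e <;>
    rcases face_eq_iff.1 e with ⟨h1, h2, h3⟩ | ⟨h1, h2, h3⟩ | ⟨h1, h2, h3⟩ <;>
    simp only [Option.some.injEq, reduceCtorEq] at h3 <;> subst h3 <;>
    first
    | exact .inl rfl
    | exact .inr (.inl rfl)
    | exact .inr (.inr ⟨_, by omega, rfl⟩)

theorem split_fan_eq_turn {p z : ℝ} {c : ℕ → ℝ} {m : ℕ}
    (hz : ∀ i ≤ m, z < c i) :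
    split (Fan z c (m + 1)) (some (P z)) (some (P (c 0))) none (P p) = Turn p z c m 0 := by
  have hne : ∀ i ≤ m, c i ≠ z := fun i hi => (hz i hi).ne'
  have hne' : ∀ i ≤ m, z ≠ c i := fun i hi => (hz i hi).ne
  ext f
  simp only [split, Set.mem_union, Set.mem_sdiff, Set.mem_singleton_iff, Set.mem_insert_iff]
  constructor
  · rintro (⟨h, hf⟩ | rfl | rfl | rfl)
    · rcases mem_fan.1 h with ⟨i, hi, rfl⟩ | ⟨i, hi, rfl⟩ | rfl | rfl
      · exact .old i i.zero_le (by omega)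
      · exact .hull i (by omega)
      · exact absurd rfl hf
      · exact .last
    · rw [← face_rotate]; exact .center
    · rw [← face_rotate]; exact .first
    · rw [face_rotate]; exact .left
  · intro h
    rcases mem_turn.1 h with rfl | ⟨i, hi, rfl⟩ | ⟨i, hj, hi, rfl⟩ | ⟨i, hi, rfl⟩ | rfl | rfl | rfl
    · exact .inr (.inl (by simp [face_eq_iff]))
    · omega
    · exact .inl ⟨.bounded i (by omega), by simp [face_eq_iff]⟩
    · exact .inl ⟨.hull i (by omega), by simp [face_eq_iff, hne i (by omega)]⟩
    · exact .inl ⟨.last, by simp [face_eq_iff, hne m (by omega)]⟩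
    · exact .inr (.inr (.inr (by simp [face_eq_iff])))
    · exact .inr (.inr (.inl (by simp [face_eq_iff])))

/-- Once only the spoke to `c m` is left at the old centre, that centre is an ordinary outer point
of the fan around the new one. -/
theorem turn_self_eq_fan {c : ℕ → ℝ} (m : ℕ) :
    Turn (c (m + 2)) (c (m + 1)) c m m = Fan (c (m + 2)) c (m + 2) := by
  ext f
  constructor
  · intro h
    rcases mem_turn.1 h with rfl | ⟨i, hi, rfl⟩ | ⟨i, hj, hi, rfl⟩ | ⟨i, hi, rfl⟩ | rfl | rfl | rfl
    · exact .bounded m (by omega)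
    · exact .bounded i (by omega)
    · omega
    · exact .hull i (by omega)
    · exact .hull m (by omega)
    · exact .last
    · exact .first
  · intro h
    rcases mem_fan.1 h with ⟨i, hi, rfl⟩ | ⟨i, hi, rfl⟩ | rfl | rfl
    · rcases (by omega : i < m ∨ i = m) with hi | rfl
      exacts [.flipped i hi, .center]
    · rcases (by omega : i < m ∨ i = m) with hi | rfl
      exacts [.hull i hi, .last]
    · exact .first
    · exact .left

theorem turn_succ {p z : ℝ} {c : ℕ → ℝ} {m j : ℕ} (hc : StrictAnti c) (hpz : p < z)
    (hz : ∀ i ≤ m, z < c i) (hj : j < m) :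
    (Turn p z c m j \ {face (some (P (c j))) (some (P z)) (some (P (c (j + 1)))),
        face (some (P z)) (some (P (c j))) (some (P p))}) ∪
      {face (some (P (c j))) (some (P p)) (some (P (c (j + 1)))),
        face (some (P p)) (some (P z)) (some (P (c (j + 1))))} = Turn p z c m (j + 1) := by
  have hci : ∀ i j, c i = c j ↔ i = j := fun _ _ => hc.injective.eq_iff
  have hne : ∀ i ≤ m, c i ≠ z := fun i hi => (hz i hi).ne'
  have hne' : ∀ i ≤ m, z ≠ c i := fun i hi => (hz i hi).ne
  have hpne : ∀ i ≤ m, p ≠ c i := fun i hi => (hpz.trans (hz i hi)).ne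
  have hpne' : ∀ i ≤ m, c i ≠ p := fun i hi => (hpz.trans (hz i hi)).ne'
  ext f
  simp only [Set.mem_union, Set.mem_sdiff, Set.mem_singleton_iff, Set.mem_insert_iff, not_or]
  constructor
  · rintro (⟨h, hf1, hf2⟩ | rfl | rfl)
    · rcases mem_turn.1 h with rfl | ⟨i, hi, rfl⟩ | ⟨i, hji, hi, rfl⟩ | ⟨i, hi, rfl⟩ |
        rfl | rfl | rfl
      · exact absurd (by simp [face_eq_iff]) hf2
      · exact .flipped i (by omega)
      · rcases (by omega : i = j ∨ j + 1 ≤ i) with rfl | h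
        · exact absurd (by simp [face_eq_iff]) hf1
        · exact .old i h hi
      exacts [.hull i hi, .last, .left, .first]
    · rw [face_rotate]; exact .flipped j (by omega)
    · exact .center
  · intro h
    rcases mem_turn.1 h with rfl | ⟨i, hi, rfl⟩ | ⟨i, hji, hi, rfl⟩ | ⟨i, hi, rfl⟩ |
      rfl | rfl | rfl
    · exact .inr (.inr rfl)
    · rcases (by omega : i < j ∨ i = j) with hi | rfl
      · refine .inl ⟨.flipped i hi, ?_, ?_⟩ <;>
          simp [face_eq_iff, hci, hpne _ hj.le, hpz.ne,
            hne i (by omega), hne (i + 1) (by omega)]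
      · exact .inr (.inl (by simp [face_eq_iff]))
    · refine .inl ⟨.old i (by omega) hi, ?_, ?_⟩ <;>
        simp [face_eq_iff, hci, hpz.ne', hne' j hj.le, hne' (j + 1) hj, hpne' i hi.le,
          hne (i + 1) hi, hne i hi.le]
      omega
    · exact .inl ⟨.hull i hi, by simp [face_eq_iff], by simp [face_eq_iff]⟩
    · exact .inl ⟨.last, by simp [face_eq_iff], by simp [face_eq_iff]⟩
    · exact .inl ⟨.left, by simp [face_eq_iff], by simp [face_eq_iff]⟩
    · exact .inl ⟨.first, by simp [face_eq_iff], by simp [face_eq_iff]⟩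

/-- The faces of `Turn p z c m j` whose circumdisk contains a vertex. -/
theorem conflict_of_mem_turn {p z : ℝ} {c : ℕ → ℝ} {m j : ℕ} (hc : StrictAnti c) (hp : 0 < p)
    (hpz : p < z) (hz : ∀ i ≤ m, z < c i) (hj : j ≤ m) {a b x : Vertex} {d : Point}
    (hf : face a b x ∈ Turn p z c m j) (hd : d = P p ∨ d = P z ∨ ∃ i ≤ m, d = P (c i))
    (h : InDisk a b x d) :
    (face a b x = face (some (P p)) (some (P z)) (some (P (c j))) ∧
      ∃ i, j < i ∧ i ≤ m ∧ d = P (c i)) ∨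
    (∃ i, j ≤ i ∧ i < m ∧
      face a b x = face (some (P z)) (some (P (c (i + 1)))) (some (P (c i))) ∧ d = P p) := by
  obtain ⟨y, rfl, hy⟩ : ∃ y, d = P y ∧ (y = p ∨ y = z ∨ ∃ i ≤ m, y = c i) := by
    rcases hd with rfl | rfl | ⟨i, hi, rfl⟩
    exacts [⟨p, rfl, .inl rfl⟩, ⟨z, rfl, .inr (.inl rfl)⟩, ⟨c i, rfl, .inr (.inr ⟨i, hi, rfl⟩)⟩]
  have hpy : p ≤ y := by
    rcases hy with rfl | rfl | ⟨i, hi, rfl⟩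
    exacts [le_rfl, hpz.le, (hpz.trans (hz i hi)).le]
  have hyc : y ≤ c 0 := by
    rcases hy with rfl | rfl | ⟨i, hi, rfl⟩
    exacts [(hpz.trans (hz 0 m.zero_le)).le, (hz 0 m.zero_le).le, hc.antitone i.zero_le]
  have hlow : ∀ i < m, y ≤ z → 0 ≤ (y - c (i + 1)) * (y - c i) := fun i hi h =>
    mul_nonneg_of_nonpos_of_nonpos (sub_nonpos.2 (h.trans (hz _ hi).le))
      (sub_nonpos.2 (h.trans (hz _ hi.le).le))
  have hgap : ∀ i < m, 0 ≤ (y - c (i + 1)) * (y - c i) := by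
    intro i hi
    rcases hy with rfl | rfl | ⟨l, hl, rfl⟩
    · exact hlow i hi hpz.le
    · exact hlow i hi le_rfl
    · exact sub_mul_sub_nonneg_of_strictAnti hc i l
  rcases mem_turn.1 hf with e | ⟨i, hi, e⟩ | ⟨i, hji, hi, e⟩ | ⟨i, hi, e⟩ | e | e | e
  · refine .inl ⟨e, ?_⟩
    have h' := h.of_face_eq e
    by_contra hcon
    refine not_inDisk_bounded hp hpz (hz j hj) hpy ?_ h'
    rcases hy with rfl | rfl | ⟨l, hl, rfl⟩
    · exact mul_nonneg_of_nonpos_of_nonpos (by linarith) (by linarith [hz j hj])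
    · simp
    · have hlj : l ≤ j := by
        by_contra hlj
        exact hcon ⟨l, by omega, hl, rfl⟩
      exact mul_nonneg (by linarith [hz l hl]) (sub_nonneg.2 (hc.antitone hlj))
  · exact absurd (h.of_face_eq e) (not_inDisk_bounded hp (hpz.trans (hz _ (by omega)))
      (hc (Nat.lt_succ_self i)) hpy (hgap i (by omega)))
  · refine .inr ⟨i, hji, hi, e, ?_⟩
    by_contra hcon
    refine not_inDisk_bounded (hp.trans hpz) (hz _ hi) (hc (Nat.lt_succ_self i)) ?_ (hgap i hi)
      (h.of_face_eq e)
    rcases hy with rfl | rfl | ⟨l, hl, rfl⟩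
    exacts [absurd rfl hcon, le_rfl, (hz l hl).le]
  · exact absurd (h.of_face_eq e) (not_inDisk_hull (hc (Nat.lt_succ_self i)) (hgap i hi))
  · refine absurd (h.of_face_eq e) (not_inDisk_hull (hz _ le_rfl) ?_)
    rcases hy with rfl | rfl | ⟨l, hl, rfl⟩
    · exact mul_nonneg_of_nonpos_of_nonpos (by linarith) (by linarith [hz m le_rfl])
    · simp
    · exact mul_nonneg (by linarith [hz l hl]) (sub_nonneg.2 (hc.antitone hl))
  · refine absurd (h.of_face_eq e) (not_inDisk_hull hpz ?_)
    rcases hy with rfl | rfl | ⟨l, hl, rfl⟩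
    · simp
    · simp
    · exact mul_nonneg (by linarith [hz l hl]) (by linarith [hz l hl])
  · exact absurd (h.of_face_eq e)
      (not_inDisk_first (hpz.trans (hz 0 m.zero_le)).le hpy hyc)

/-- Only the edge from `P z` to `P (c j)` separates a face from a vertex in its circumdisk, so the
order of flips is forced. The two cases see this edge from its two sides. -/
theorem flip_turn {p z : ℝ} {c : ℕ → ℝ} {m j : ℕ} (hc : StrictAnti c) (hp : 0 < p)
    (hpz : p < z) (hz : ∀ i ≤ m, z < c i) (hj : j ≤ m) {T' : Set Face}
    (h : Flip (Turn p z c m j) T') : j < m ∧ T' = Turn p z c m (j + 1) := by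
  have hci : ∀ i j, c i = c j ↔ i = j := fun _ _ => hc.injective.eq_iff
  have hne : ∀ i ≤ m, z ≠ c i := fun i hi => (hz i hi).ne
  have hpne : ∀ i ≤ m, p ≠ c i := fun i hi => (hpz.trans (hz i hi)).ne
  obtain ⟨a, b, x, d, h1, h2, h3, rfl⟩ := h
  rcases conflict_of_mem_turn hc hp hpz hz hj h1 (vertex_mem_of_mem_turn hj h2) h3 with
    ⟨e, i, hji, him, rfl⟩ | ⟨i, hji, him, e, rfl⟩
  · have : a = some (P z) ∧ b = some (P (c j)) ∧ x = some (P p) ∧ i = j + 1 := by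
      rcases face_eq_iff.1 e with ⟨rfl, rfl, rfl⟩ | ⟨rfl, rfl, rfl⟩ | ⟨rfl, rfl, rfl⟩ <;>
      rcases mem_turn.1 h2 with e | ⟨l, hl, e⟩ | ⟨l, hjl, hl, e⟩ | ⟨l, hl, e⟩ | e | e | e <;>
      rcases face_eq_iff.1 e with ⟨h1, h2, h3⟩ | ⟨h1, h2, h3⟩ | ⟨h1, h2, h3⟩ <;>
      simp only [Option.some.injEq, P_inj, reduceCtorEq, hci] at h1 h2 h3 <;>
      grind
    obtain ⟨rfl, rfl, rfl, rfl⟩ := this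
    refine ⟨by omega, ?_⟩
    rw [← turn_succ hc hpz hz (by omega), Set.pair_comm (face (some (P z)) (some (P (c j))) _),
      Set.pair_comm (face (some (P z)) (some (P (c (j + 1)))) _),
      ← face_rotate (some (P p)) (some (P z)), face_rotate (some (P (c (j + 1)))) (some (P (c j))),
      face_rotate (some (P p)) (some (P z)) (some (P (c (j + 1))))]
  · have : a = some (P (c j)) ∧ b = some (P z) ∧ x = some (P (c (j + 1))) := by
      rcases face_eq_iff.1 e with ⟨rfl, rfl, rfl⟩ | ⟨rfl, rfl, rfl⟩ | ⟨rfl, rfl, rfl⟩ <;>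
      rcases mem_turn.1 h2 with e | ⟨l, hl, e⟩ | ⟨l, hjl, hl, e⟩ | ⟨l, hl, e⟩ | e | e | e <;>
      rcases face_eq_iff.1 e with ⟨h1, h2, h3⟩ | ⟨h1, h2, h3⟩ | ⟨h1, h2, h3⟩ <;>
      simp only [Option.some.injEq, P_inj, reduceCtorEq, hci] at h1 h2 h3 <;>
      grind
    obtain ⟨rfl, rfl, rfl⟩ := this
    exact ⟨by omega, turn_succ hc hpz hz (by omega)⟩

/-- Each flip raises `j` by one, and the process cannot stop at `j < m`, where the edge from `P z`
to `P (c j)` is still invalid. -/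
theorem flips_turn {p z : ℝ} {c : ℕ → ℝ} {m j n : ℕ} (hc : StrictAnti c) (hp : 0 < p)
    (hpz : p < z) (hz : ∀ i ≤ m, z < c i) (hj : j ≤ m) {T' : Set Face}
    (h : Flips (Turn p z c m j) n T') (hT : ¬ ∃ T'', Flip T' T'') :
    j + n = m ∧ T' = Turn p z c m m := by
  generalize hT0 : Turn p z c m j = T at h
  induction h generalizing j with
  | refl T =>
    subst hT0
    obtain rfl | hj := hj.eq_or_lt
    · exact ⟨rfl, rfl⟩
    · refine absurd ⟨_,
        ⟨some (P (c j)), some (P z), some (P (c (j + 1))), P p, ?_, ?_, ?_, rfl⟩⟩ hT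
      · rw [face_rotate]; exact .old j le_rfl hj
      · rw [← face_rotate]; exact .center
      · have := hc (Nat.lt_succ_self j)
        have h1 := hz j hj.le
        have h2 := hz (j + 1) hj
        simp only [Nat.succ_eq_add_one] at this
        simp only [InDisk, inCircle_P]
        -- The signs are distributed so that every factor is positive.
        have e : -((z - c j) * (c (j + 1) - c j) * (c (j + 1) - z)) *
            ((p - c j) * (p - z) * (p - c (j + 1))) * (c j + z + c (j + 1) + p) =
            ((c j - z) * (c j - c (j + 1)) * (c (j + 1) - z)) *
            ((c j - p) * (z - p) * (c (j + 1) - p)) * (c j + z + c (j + 1) + p) := by ring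
        rw [e]
        have h3 : 0 < c j - z := by linarith
        have h4 : 0 < c j - c (j + 1) := by linarith
        have h5 : 0 < c (j + 1) - z := by linarith
        have h6 : 0 < c j - p := by linarith
        have h7 : 0 < z - p := by linarith
        have h8 : 0 < c (j + 1) - p := by linarith
        have h9 : 0 < c j + z + c (j + 1) + p := by linarith
        positivity
  | step h _ ih =>
    subst hT0
    obtain ⟨hlt, rfl⟩ := flip_turn hc hp hpz hz hj h
    obtain ⟨h1, h2⟩ := ih hlt hT rfl
    exact ⟨by omega, h2⟩

/-- Inserting a point smaller than the centre of a fan flips all its bounded triangles. -/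
theorem insertion_fan_smallest {c : ℕ → ℝ} (hc : StrictAnti c) (hpos : ∀ i, 0 < c i) (m : ℕ)
    {o : Outcome} (h : Insertion (Fan (c (m + 1)) c (m + 1)) (P (c (m + 1))) (P (c (m + 2))) o) :
    o.flips = m ∧ o.next = Fan (c (m + 2)) c (m + 2) := by
  have hz : ∀ i ≤ m, c (m + 1) < c i := fun i hi => hc (by omega)
  obtain ⟨t, ht, hn, hq, u, v, w, hw, hfl, hnf⟩ := h
  obtain ⟨i, hi, rfl⟩ := bounded_of_mem_fan ht hn
  obtain ⟨-, e⟩ := walk_fan_outside hc (fun i hi => hz i (by omega))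
    (.inl (hc (Nat.lt_succ_self _))) hi hw
  rw [split_of_face_eq _ _ e, split_fan_eq_turn hz] at hfl
  obtain ⟨h1, h2⟩ := flips_turn hc (hpos _) (hc (Nat.lt_succ_self _)) hz m.zero_le hfl hnf
  exact ⟨by omega, by rw [h2]; exact turn_self_eq_fan m⟩

/-! ## Runs -/

theorem LinearFrom.of_append {G : IncrementalAlgorithm} {k : ℕ} {T : Set Face} {q : Point}
    {x y : List Point} (h : LinearFrom G k T q (x ++ y)) : LinearFrom G k T q x := by
  induction x generalizing T q with
  | nil => trivial
  | cons p x ih => exact ⟨h.1, h.2.1, h.2.2.1, ih h.2.2.2⟩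

theorem KDLinear.of_append {G : IncrementalAlgorithm} {k : ℕ} {x y : List Point}
    (h : KDLinear G k (x ++ y)) : KDLinear G k x := by
  match x, h with
  | [], _ => trivial
  | [_], _ => trivial
  | [_, _], _ => trivial
  | _ :: _ :: _ :: _, h => exact LinearFrom.of_append (y := y) h

/-- Linearity passes to prefixes, so the greedy algorithm does not break inside a stretch whose
whole extension is linear. -/
theorem greedyFrom_append {G : IncrementalAlgorithm} {k : ℕ} {cur x : List Point}
    (y : List Point) (h : KDLinear G k (cur ++ x)) :
    greedyFrom G k cur (x ++ y) = greedyFrom G k (cur ++ x) y := by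
  induction x generalizing cur with
  | nil => simp
  | cons p x ih =>
    rw [List.append_cons] at h
    rw [List.cons_append, greedyFrom, if_pos h.of_append, ih h, ← List.append_cons]

theorem greedyFrom_break {G : IncrementalAlgorithm} {k : ℕ} {cur : List Point} {p : Point}
    (y : List Point) (h : ¬ KDLinear G k (cur ++ [p])) :
    greedyFrom G k cur (p :: y) = cur :: greedyFrom G k [p] y := by
  rw [greedyFrom, if_neg h]

/-- The combinatorial core: greedy keeps `x` in the first run and pays for it with a third, while
moving `x` to the front of the second run lets that run reach `y`. -/
theorem greedy_three_optimal_two {G : IncrementalAlgorithm} {k : ℕ} {a x b y : Point}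
    {A C : List Point} (h1 : KDLinear G k (a :: A ++ [x]))
    (h2 : ¬ KDLinear G k (a :: A ++ [x] ++ [b])) (h3 : KDLinear G k (b :: C))
    (h4 : ¬ KDLinear G k (b :: C ++ [y])) (h5 : KDLinear G k (x :: b :: C ++ [y])) :
    (greedyPartition G k (a :: A ++ x :: b :: C ++ [y])).length = 3 ∧
      IsLeast {m : ℕ | ∃ R : List (List Point),
        IsRunPartition G k (a :: A ++ x :: b :: C ++ [y]) R ∧ R.length = m} 2 := by
  refine ⟨?_, ⟨[a :: A, x :: b :: C ++ [y]], ⟨by simp, ?_⟩, rfl⟩, ?_⟩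
  · have e : a :: A ++ x :: b :: C ++ [y] = a :: ((A ++ [x]) ++ (b :: (C ++ [y]))) := by simp
    rw [e, greedyPartition, greedyFrom_append _ (by simpa using h1),
      greedyFrom_break _ (by simpa using h2), greedyFrom_append _ (by simpa using h3),
      greedyFrom_break _ (by simpa using h4)]
    rfl
  · intro r hr
    simp only [List.mem_cons, List.not_mem_nil, or_false] at hr
    rcases hr with rfl | rfl
    exacts [⟨by simp, h1.of_append⟩, ⟨by simp, h5⟩]
  · rintro m ⟨R, ⟨hR, hlin⟩, rfl⟩
    match R, hR, hlin with
    | [], hR, _ => simp at hR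
    | [r], hR, hlin =>
      obtain rfl : r = a :: A ++ x :: b :: C ++ [y] := by simpa using hR
      -- A single run would contain the prefix that already fails at `b`.
      refine absurd (hlin _ List.mem_cons_self).2 fun h => h2 (KDLinear.of_append (y := C ++ [y]) (x := a :: A ++ [x] ++ [b]) ?_)
      simpa using h
    | _ :: _ :: _, _, _ => simp

/-! ## Runs on the parabola -/

theorem initial_second_smallest {z : ℝ} {c : ℕ → ℝ} (hc : StrictAnti c) (hz : ∀ i, z < c i) :
    initial (P z) (P (c 0)) (P (c 1)) = Fan z c 2 := by
  have h : orient (P z) (P (c 0)) (P (c 1)) < 0 := by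
    rw [orient_P]
    exact mul_neg_of_pos_of_neg (mul_pos (sub_pos.2 (hz _)) (sub_pos.2 (hz _)))
      (sub_neg.2 (hc Nat.zero_lt_one))
  rw [initial, if_neg h.not_gt]
  ext f
  rw [mem_fan]
  simp [triangle, face_rotate (some (P (c 0)))]
  tauto

theorem initial_smallest {c : ℕ → ℝ} (hc : StrictAnti c) :
    initial (P (c 0)) (P (c 1)) (P (c 2)) = Fan (c 2) c 2 := by
  have h : orient (P (c 0)) (P (c 1)) (P (c 2)) < 0 := by
    rw [orient_P]
    exact mul_neg_of_pos_of_neg (mul_pos_of_neg_of_neg (sub_neg.2 (hc Nat.zero_lt_one))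
      (sub_neg.2 (hc Nat.zero_lt_two))) (sub_neg.2 (hc Nat.one_lt_two))
  rw [initial, if_neg h.not_gt]
  ext f
  rw [mem_fan]
  simp [triangle, face_rotate (some (P (c 2)))]

/-- Each of these points costs one crossing, which `0 < k` allows, and leads to the next fan; only
the continuation `S` can fail. -/
theorem linearFrom_fan_iff {z : ℝ} {c : ℕ → ℝ} (hc : StrictAnti c) (hz0 : 0 < z)
    (hz : ∀ i, z < c i) (G : IncrementalAlgorithm) {k : ℕ} (hk : 0 < k) (S : List Point)
    (r m : ℕ) :
    LinearFrom G k (Fan z c (m + 2)) (P (c (m + 1)))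
        ((List.range' (m + 2) r).map (fun i => P (c i)) ++ S) ↔
      LinearFrom G k (Fan z c (m + r + 2)) (P (c (m + r + 1))) S := by
  induction r generalizing m with
  | zero => simp
  | succ r ih =>
    have hins := G.correct _ _ _ ⟨_, (insertion_fan_iff hc hz0 hz m
      ⟨1, 0, Fan z c (m + 3)⟩).2 ⟨rfl, rfl, rfl⟩⟩
    obtain ⟨h1, h2, h3⟩ := (insertion_fan_iff hc hz0 hz m _).1 hins
    have := ih (m + 1)
    rw [List.range'_succ, List.map_cons, List.cons_append, LinearFrom, h1, h2, h3, this,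
      show m + 1 + r = m + (r + 1) by omega]
    exact ⟨fun h => h.2.2.2, fun h => ⟨hins, hk, k.zero_le, h⟩⟩

/-- A run that consists of the smallest point and then the others in decreasing order. -/
theorem kdLinear_fan_iff {z : ℝ} {c : ℕ → ℝ} (hc : StrictAnti c) (hz0 : 0 < z)
    (hz : ∀ i, z < c i) (G : IncrementalAlgorithm) {k : ℕ} (hk : 0 < k) (S : List Point)
    (r : ℕ) :
    KDLinear G k (P z :: (List.range' 0 (r + 2)).map (fun i => P (c i)) ++ S) ↔
      LinearFrom G k (Fan z c (r + 2)) (P (c (r + 1))) S := by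
  have := linearFrom_fan_iff hc hz0 hz G hk S r 0
  rw [← initial_second_smallest hc hz] at this
  simpa [List.range'_succ, KDLinear] using this

theorem kdLinear_fan {z : ℝ} {c : ℕ → ℝ} (hc : StrictAnti c) (hz0 : 0 < z)
    (hz : ∀ i, z < c i) (G : IncrementalAlgorithm) {k : ℕ} (hk : 0 < k) (r : ℕ) :
    KDLinear G k (P z :: (List.range' 0 (r + 2)).map fun i => P (c i)) := by
  have := (kdLinear_fan_iff hc hz0 hz G hk [] r).2 trivial
  rwa [List.append_nil] at this

/-- In a fan, the walk from the second smallest point to a new largest point is long. -/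
theorem not_kdLinear_fan_largest {z y : ℝ} {c : ℕ → ℝ} (hc : StrictAnti c) (hz0 : 0 < z)
    (hz : ∀ i, z < c i) (hy : c 0 < y) (G : IncrementalAlgorithm) {k r : ℕ} (hk : 0 < k)
    (hr : k ≤ r) :
    ¬ KDLinear G k (P z :: (List.range' 0 (r + 2)).map (fun i => P (c i)) ++ [P y]) := by
  rw [kdLinear_fan_iff hc hz0 hz G hk]
  rintro ⟨⟨t, ht, hn, hq, u, v, w, hw, -⟩, hnav, -⟩
  obtain ⟨i, hi, rfl⟩ := bounded_of_mem_fan ht hn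
  have him : i = r := by
    simp only [mem_face, Option.some.injEq, P_inj, hc.injective.eq_iff, (hz _).ne',
      false_or] at hq
    omega
  subst him
  have := (walk_fan_outside hc (fun i _ => hz i) (.inr hy) hi hw).1
  omega

/-- Inserting `c (m + 2)` takes `m` flips and each later point one more, so the last of the `r + 1`
points takes `m + r`. -/
theorem le_of_linearFrom_decreasing {c : ℕ → ℝ} (hc : StrictAnti c) (hpos : ∀ i, 0 < c i)
    (G : IncrementalAlgorithm) {k : ℕ} (r m : ℕ)
    (h : LinearFrom G k (Fan (c (m + 1)) c (m + 1)) (P (c (m + 1)))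
      ((List.range' (m + 2) (r + 1)).map fun i => P (c i))) : m + r ≤ k := by
  induction r generalizing m with
  | zero =>
    obtain ⟨h1, -, h2, -⟩ := h
    rwa [(insertion_fan_smallest hc hpos m h1).1] at h2
  | succ r ih =>
    obtain ⟨h1, -, -, h2⟩ := h
    rw [(insertion_fan_smallest hc hpos m h1).2] at h2
    have := ih (m + 1) h2
    omega

/-- Long decreasing sequences need many flips. -/
theorem not_kdLinear_decreasing {c : ℕ → ℝ} (hc : StrictAnti c) (hpos : ∀ i, 0 < c i)
    (G : IncrementalAlgorithm) (k : ℕ) :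
    ¬ KDLinear G k ((List.range' 0 (k + 4)).map fun i => P (c i)) := by
  intro h
  -- After the initial triangle the insertions cost `1, 2, …, k + 1` flips, and the last one exceeds
  -- `k`.
  have h' : LinearFrom G k (Fan (c 2) c 2) (P (c 2))
      ((List.range' 3 (k + 1)).map fun i => P (c i)) := by
    rw [← initial_smallest hc]
    simpa [List.range'_succ, KDLinear] using h
  have := le_of_linearFrom_decreasing hc hpos G k 1 h'
  omega

/-! ### The concrete sequence -/

theorem strictAnti_add_inv (t : ℝ) : StrictAnti fun i : ℕ => t + 1 / ((i : ℝ) + 1) := by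
  intro i j h
  have : (i : ℝ) < j := by exact_mod_cast h
  exact add_lt_add_right (one_div_lt_one_div_of_lt (by positivity) (by linarith)) t

theorem lt_add_inv (t : ℝ) (i : ℕ) : t < t + 1 / ((i : ℝ) + 1) :=
  lt_add_of_pos_right t (by positivity)

theorem add_inv_le (t : ℝ) (i : ℕ) : t + 1 / ((i : ℝ) + 1) ≤ t + 1 := by
  have := (strictAnti_add_inv t).antitone i.zero_le
  simpa using this

theorem exists_greedy_three_optimal_two {k n : ℕ} (hk : 0 < k) (hn : 2 * k + 8 ≤ n)
    (G : IncrementalAlgorithm) :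
    ∃ S : List Point, S.length = n ∧ GeneralPosition S ∧ (greedyPartition G k S).length = 3 ∧
      IsLeast {m : ℕ | ∃ R : List (List Point), IsRunPartition G k S R ∧ R.length = m} 2 := by
  classical
  obtain ⟨a, ha, ha1, ha2⟩ : ∃ a : ℕ → ℝ, StrictAnti a ∧ (∀ i, 1 < a i) ∧ ∀ i, a i ≤ 2 :=
    ⟨_, strictAnti_add_inv 1, lt_add_inv 1, fun i => (add_inv_le 1 i).trans (by norm_num)⟩
  obtain ⟨c, hc, hc3⟩ : ∃ c : ℕ → ℝ, StrictAnti c ∧ ∀ i, 3 < c i :=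
    ⟨_, strictAnti_add_inv 3, lt_add_inv 3⟩
  have hac : ∀ i j, a i < c j := fun i j => by linarith [ha2 i, hc3 j]
  have hex : ∃ M, ¬ KDLinear G k ((List.range' 0 M).map fun i => P (c i)) :=
    ⟨k + 4, not_kdLinear_decreasing hc (fun i => by linarith [hc3 i]) G k⟩
  -- `M + 2` is the least length at which the decreasing run fails; it is at least 2 because lists
  -- of length 0 and 1 are linear. Taking the minimum avoids computing where the run breaks.
  obtain ⟨M, hM1, hM2, hMk⟩ : ∃ M, KDLinear G k ((List.range' 0 (M + 1)).map fun i => P (c i)) ∧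
      ¬ KDLinear G k ((List.range' 0 (M + 2)).map fun i => P (c i)) ∧ M + 2 ≤ k + 4 := by
    have hle : Nat.find hex ≤ k + 4 :=
      Nat.find_min' hex (not_kdLinear_decreasing hc (fun i => by linarith [hc3 i]) G k)
    have hspec := Nat.find_spec hex
    obtain ⟨M, hM⟩ : ∃ M, Nat.find hex = M + 2 := by
      rcases h : Nat.find hex with _ | _ | M
      · rw [h] at hspec; exact absurd trivial hspec
      · rw [h] at hspec; exact absurd trivial hspec
      · exact ⟨M, rfl⟩
    refine ⟨M, not_not.1 (Nat.find_min hex (m := M + 1) (by omega)), ?_, by omega⟩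
    rwa [hM] at hspec
  -- The lengths are `1 + (L + 2) + (M + 2)`. Since `M ≤ k + 2`, the bound `2 * k + 8 ≤ n` leaves `k
  -- ≤ L`, enough for the long walk to `c 0`.
  obtain ⟨L, rfl⟩ : ∃ L, n = L + M + 5 := ⟨n - M - 5, by omega⟩
  have e1 : ∀ r, (List.range' 0 (r + 1)).map (fun i => P (c i)) =
      P (c 0) :: (List.range' 1 r).map fun i => P (c i) := fun r => by
    simp [List.range'_succ]
  have e2 : ∀ (c : ℕ → ℝ) (r : ℕ), (List.range' 0 (r + 1)).map (fun i => P (c i)) =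
      (List.range' 0 r).map (fun i => P (c i)) ++ [P (c r)] := fun c r => by
    simp [List.range'_1_concat]
  have h1 := kdLinear_fan ha one_pos ha1 G hk L
  have h2 := not_kdLinear_fan_largest ha one_pos ha1 (hac 0 0) G (r := L) hk (by omega)
  -- The second optimal run: `a (L + 1)` is the centre below all `c i`.
  have h5 := kdLinear_fan hc (by linarith [ha1 (L + 1)]) (hac (L + 1)) G hk M
  rw [e2 a] at h1 h2
  rw [e2 c, e1] at hM2 h5
  rw [e1] at hM1
  refine ⟨_, ?_, ?_, greedy_three_optimal_two h1 h2 hM1 hM2 h5⟩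
  · simp
    omega
  · have hmap : P 1 :: (List.range' 0 (L + 1)).map (fun i => P (a i)) ++ P (a (L + 1)) ::
        P (c 0) :: (List.range' 1 M).map (fun i => P (c i)) ++ [P (c (M + 1))] =
        (1 :: ((List.range' 0 (L + 2)).map a ++ (List.range' 0 (M + 2)).map c)).map P := by
      simp only [List.map_cons, List.map_append, List.map_map, Function.comp_def]
      rw [e2 a (L + 1), e2 c (M + 1), e1]
      simp
    rw [hmap]
    refine generalPosition_map_P ?_ ?_
    · rw [List.nodup_cons, List.nodup_append]
      refine ⟨?_, List.Nodup.map ha.injective List.nodup_range', List.Nodup.map hc.injective List.nodup_range', ?_⟩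
      · simp only [List.mem_append, List.mem_map, not_or, not_exists, not_and]
        exact ⟨fun i _ => (ha1 i).ne', fun i _ => ((ha1 i).trans (hac i i)).ne'⟩
      · simp only [List.forall_mem_map]
        exact fun i _ j _ => (hac i j).ne
    · simp only [List.forall_mem_cons, List.forall_mem_append, List.forall_mem_map]
      exact ⟨one_pos, fun i _ => one_pos.trans (ha1 i), fun i _ => by linarith [hc3 i]⟩

end DLinear

theorem mainTheorem6 (k : ℕ) (hk : 0 < k) :
    ∃ N : ℕ, ∀ n : ℕ, N ≤ n → ∀ G : DLinear.IncrementalAlgorithm,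
      ∃ S : List DLinear.Point,
        S.length = n ∧ DLinear.GeneralPosition S ∧
        (DLinear.greedyPartition G k S).length = 3 ∧
        IsLeast {m : ℕ | ∃ R : List (List DLinear.Point),
          DLinear.IsRunPartition G k S R ∧ R.length = m} 2 :=
  ⟨2 * k + 8, fun _ hn G => DLinear.exists_greedy_three_optimal_two hk hn G⟩
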